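/- Let $\mathfrak c = 2^{\aleph_0}$ and let $\eta$ be the Euclidean topology on $\mathbb R$. For a topology $\tau$ on $\mathbb R$ let $\Gamma(\tau)$ be the set of all $x\in\mathbb R$ at which the neighborhood filters of $x$ with respect to $\eta$ and to $\tau$ are different. Then there is a family $\mathcal F$ of topologies on $\mathbb R$ with $|\mathcal F| = 2^{\mathfrak c}$ such that every $\tau\in\mathcal F$ is finer than $\eta$ and satisfies $\Gamma(\tau)=\mathbb R$, every space $(\mathbb R,\tau)$ with $\tau\in\mathcal F$ is connected, separable and metrizable, and the spaces $(\mathbb R,\tau)$, $\tau\in\mathcal F$, are incomparable in the following sense: if $\sigma,\tau\in\mathcal F$ and $(\mathbb R,\sigma)$ is homeomorphic to the subspace $S\subseteq\mathbb R$ of $(\mathbb R,\tau)$, then $\sigma=\tau$ and $S=\mathbb R$. (That is, the spaces are mutually non-homeomorphic and none is homeomorphic to a proper subspace of itself or of another one.) -/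

import Mathlib

open scoped Topology

/-- The Euclidean topology `η` on the real line. -/
abbrev euclideanTopology : TopologicalSpace ℝ := inferInstance

/-- `τ` is finer than (or equal to) the Euclidean topology: Euclidean open sets are `τ`-open. -/
def RefinesEuclidean (τ : TopologicalSpace ℝ) : Prop :=
  ∀ U : Set ℝ, IsOpen[euclideanTopology] U → IsOpen[τ] U

/-- `Γ(τ)`: the points at which the neighborhood filters of `η` and `τ` differ. -/
def strictPoints (τ : TopologicalSpace ℝ) : Set ℝ :=
  {x : ℝ | @nhds ℝ euclideanTopology x ≠ @nhds ℝ τ x}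

/-- The spaces `(X, τ)`, `τ ∈ 𝓕`, are incomparable: for `σ, τ ∈ 𝓕` the space `(X, σ)` is
homeomorphic to a subspace `S` of `(X, τ)` only in the trivial case `(X, σ) = S = (X, τ)`. -/
def Incomparable {X : Type*} (𝓕 : Set (TopologicalSpace X)) : Prop :=
  ∀ σ ∈ 𝓕, ∀ τ ∈ 𝓕, ∀ S : Set X,
    Nonempty (@Homeomorph X S σ (TopologicalSpace.induced ((↑) : S → X) τ)) →
      σ = τ ∧ S = Set.univ

/-!
For `f : X → Y` let `graphTopology f` be the topology of the graph of `f`, carried over to `X`.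
A Bernstein-type transfinite recursion of length `𝔠` prescribes finitely many values of `f` at each
step and leaves `𝔠` points free, so that it has `2 ^ 𝔠` solutions. One half of the steps makes
the graph meet every closed subset of `X × Y` with a projection of size `𝔠`; such a graph is
connected, and `f` maps every nonempty open set onto `Y`. The other half deals with rigidity: a
continuous map between two graphs is determined by its values on a dense sequence, hence is one of
`𝔠` maps `F` on `X × Y` known in advance. If `F` moves first coordinates in an essential way, put
into all graphs a point `p` and a point `q ≠ F p` above the first coordinate of `F p`; then `F` no
longer maps a graph into a graph. A topology is the graph topology of at most `𝔠` functions, so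
`2 ^ 𝔠` topologies remain.
-/

open Set Filter Cardinal Topology TopologicalSpace

universe u v

/-! ### Bernstein-type selections -/

theorem mk_iUnion_lt_of_finite {ι α : Type u} {κ : Cardinal.{u}} (hκ : ℵ₀ ≤ κ) (hι : #ι < κ)
    {s : ι → Set α} (hs : ∀ i, (s i).Finite) : #(⋃ i, s i) < κ := by
  rcases finite_or_infinite ι with h | h
  · exact (finite_iUnion hs).lt_aleph0.trans_le hκ
  · calc #(⋃ i, s i) ≤ #ι * ⨆ i, #(s i) := mk_iUnion_le _
      _ ≤ #ι * ℵ₀ := by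
          gcongr
          exact ciSup_le' fun i => (hs i).lt_aleph0.le
      _ = #ι := mul_aleph0_eq (aleph0_le_mk ι)
      _ < κ := hι

theorem exists_pairwise_disjoint_selection {I α : Type u} {D : Type v} {κ : Cardinal.{u}}
    (hκ : ℵ₀ ≤ κ) (hI : #I ≤ κ) {supp : D → Set α} (hsupp : ∀ d, (supp d).Finite)
    {𝒟 : I → Set D} (h𝒟 : ∀ i (T : Set α), #T < κ → ∃ d ∈ 𝒟 i, Disjoint (supp d) T) :
    ∃ d : I → D, (∀ i, d i ∈ 𝒟 i) ∧ Pairwise fun i j => Disjoint (supp (d i)) (supp (d j)) := by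
  obtain ⟨r, wo, hr⟩ := exists_ord_eq I
  have mk_below_lt (i : I) : #{j // r j i} < κ := by
    rw [← Ordinal.card_typein (r := r) i]
    exact (card_typein_lt i hr).trans_le hI
  have mk_used_lt (i : I) (e : {j // r j i} → D) : #(⋃ j, supp (e j)) < κ :=
    mk_iUnion_lt_of_finite hκ (mk_below_lt i) fun j => hsupp (e j)
  choose next next_mem next_disjoint using
    fun i (e : {j // r j i} → D) => h𝒟 i _ (mk_used_lt i e)
  let d : I → D := wo.wf.fix fun i e => next i fun j => e j.1 j.2
  have d_eq (i : I) : d i = next i fun j => d j.1 := wo.wf.fix_eq _ i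
  have disjoint_of_lt {i j : I} (hij : r i j) : Disjoint (supp (d j)) (supp (d i)) := by
    rw [d_eq j]
    exact (next_disjoint j fun k => d k.1).mono_right
      (subset_iUnion (fun k : {k // r k j} => supp (d k.1)) ⟨i, hij⟩)
  refine ⟨d, fun i => d_eq i ▸ next_mem i _, fun i j hij => ?_⟩
  rcases trichotomous_of r i j with h | h | h
  exacts [(disjoint_of_lt h).symm, absurd h hij, disjoint_of_lt h]

theorem exists_forall_mem_eq_of_injOn_fst {X : Type u} {Y : Type v} [Nonempty Y] {G : Set (X × Y)}
    (hG : InjOn Prod.fst G) : ∃ f : X → Y, ∀ p ∈ G, f p.1 = p.2 := by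
  rcases G.eq_empty_or_nonempty with rfl | ⟨p₀, -⟩
  · exact ⟨fun _ => Classical.arbitrary Y, fun _ hp => hp.elim⟩
  · have : Nonempty (X × Y) := ⟨p₀⟩
    exact ⟨fun x => (Function.invFunOn Prod.fst G x).2, fun p hp =>
      congrArg Prod.snd (hG.leftInvOn_invFunOn hp)⟩

theorem power_mk_le_mk_setOfPred_eqOn_compl {X Y : Type u} (f₀ : X → Y) (Z : Set X) :
    #Y ^ #Z ≤ #{f : X → Y | EqOn f f₀ Zᶜ} := by
  rw [power_def]
  refine mk_le_of_injective
    (f := fun h => ⟨Function.extend Subtype.val h f₀, fun x hx =>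
      Function.extend_apply' _ _ _ fun ⟨z, hz⟩ => hx (hz ▸ z.2)⟩) fun h h' hh' => ?_
  exact Function.extend_injective Subtype.val_injective f₀ (congrArg Subtype.val hh')

theorem exists_partial_function_and_free_set {X Y I : Type u} [Infinite X] [Nonempty Y]
    (hI : #I ≤ #X) {R : I → Set (Finset (X × Y))}
    (hR : ∀ i, ∀ s ∈ R i, InjOn Prod.fst (s : Set (X × Y)))
    (h : ∀ i (T : Set X), #T < #X → ∃ s ∈ R i, Disjoint (Prod.fst '' (s : Set (X × Y))) T) :
    ∃ (G : Set (X × Y)) (Z : Set X), InjOn Prod.fst G ∧ #Z = #X ∧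
      Disjoint (Prod.fst '' G) Z ∧ ∀ i, ∃ s ∈ R i, (s : Set (X × Y)) ⊆ G := by
  obtain ⟨s, hs, hdisj⟩ := exists_pairwise_disjoint_selection (I := I ⊕ X) (D := Finset (X × Y))
    (aleph0_le_mk X) (by simpa using add_le_of_le (aleph0_le_mk X) hI le_rfl)
    (supp := fun s => Prod.fst '' (s : Set (X × Y))) (fun s => s.finite_toSet.image _)
    (𝒟 := Sum.elim R fun _ => {s | s.Nonempty}) (by
      rintro (i | -) T hT
      · exact h i T hT
      · obtain ⟨x, hx⟩ := compl_nonempty_of_mk_lt_mk hT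
        exact ⟨{(x, Classical.arbitrary Y)}, Finset.singleton_nonempty _, by simpa using hx⟩)
  have eq_of_common_fst {k l : I ⊕ X} {p q : X × Y} (hp : p ∈ s k) (hq : q ∈ s l)
      (hpq : p.1 = q.1) : k = l := by
    by_contra hkl
    exact disjoint_left.1 (hdisj hkl) ⟨p, hp, rfl⟩ ⟨q, hq, hpq.symm⟩
  choose z hz using fun x => hs (.inr x)
  have z_injective : Function.Injective fun x => (z x).1 := fun x y hxy =>
    Sum.inr_injective (eq_of_common_fst (hz x) (hz y) hxy)
  refine ⟨⋃ i, s (.inl i), range fun x => (z x).1, ?_, mk_range_eq _ z_injective, ?_,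
    fun i => ⟨s (.inl i), hs (.inl i), subset_iUnion (fun i => (s (.inl i) : Set (X × Y))) i⟩⟩
  · intro p hp q hq hpq
    obtain ⟨i, hi⟩ := mem_iUnion.1 hp
    obtain ⟨j, hj⟩ := mem_iUnion.1 hq
    obtain rfl := Sum.inl_injective (eq_of_common_fst hi hj hpq)
    exact hR i _ (hs (.inl i)) hi hj hpq
  · rw [disjoint_left]
    rintro _ ⟨p, hp, rfl⟩ ⟨x, hx⟩
    obtain ⟨i, hi⟩ := mem_iUnion.1 hp
    exact Sum.inl_ne_inr (eq_of_common_fst hi (hz x) hx.symm)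

theorem exists_large_family_extending {X Y I : Type u} [Infinite X] [Nontrivial Y]
    (hI : #I ≤ #X) {R : I → Set (Finset (X × Y))}
    (hR : ∀ i, ∀ s ∈ R i, InjOn Prod.fst (s : Set (X × Y))) :
    ∃ 𝒢 : Set (X → Y), 2 ^ #X ≤ #𝒢 ∧ ∀ i,
      (∃ s ∈ R i, ∀ f ∈ 𝒢, ∀ p ∈ s, f p.1 = p.2) ∨
        ∃ T : Set X, #T < #X ∧ ∀ s ∈ R i, ∃ p ∈ s, p.1 ∈ T := by
  let J := {i // ∀ T : Set X, #T < #X → ∃ s ∈ R i, Disjoint (Prod.fst '' (s : Set (X × Y))) T}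
  obtain ⟨G, Z, hG, hZ, hdisj, hRG⟩ := exists_partial_function_and_free_set (I := J)
    ((mk_subtype_le _).trans hI) (R := fun i => R i) (fun i => hR i) fun i => i.2
  obtain ⟨f₀, hf₀⟩ := exists_forall_mem_eq_of_injOn_fst hG
  refine ⟨{f | EqOn f f₀ Zᶜ}, ?_, fun i => ?_⟩
  · calc (2 : Cardinal) ^ #X ≤ #Y ^ #Z := by
          rw [hZ]
          exact power_le_power_right (two_le_iff.2 (exists_pair_ne Y))
      _ ≤ _ := power_mk_le_mk_setOfPred_eqOn_compl f₀ Z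
  · by_cases hi : ∀ T : Set X, #T < #X → ∃ s ∈ R i, Disjoint (Prod.fst '' (s : Set (X × Y))) T
    · obtain ⟨s, hs, hsG⟩ := hRG ⟨i, hi⟩
      refine Or.inl ⟨s, hs, fun f hf p hp => ?_⟩
      rw [hf (disjoint_left.1 hdisj ⟨p, hsG hp, rfl⟩), hf₀ p (hsG hp)]
    · push Not at hi
      obtain ⟨T, hT, h⟩ := hi
      refine Or.inr ⟨T, hT, fun s hs => ?_⟩
      obtain ⟨_, ⟨p, hp, rfl⟩, hpT⟩ := not_disjoint_iff.1 (h s hs)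
      exact ⟨p, hp, hpT⟩

theorem exists_large_family_meeting_and_rigid {X Y : Type u} [Infinite X] [Nontrivial Y]
    {𝒦 : Set (Set (X × Y))} {Φ : Set (X × Y → X × Y)} (h𝒦 : #𝒦 ≤ #X) (hΦ : #Φ ≤ #X) :
    ∃ 𝒢 : Set (X → Y), 2 ^ #X ≤ #𝒢 ∧
      (∀ f ∈ 𝒢, ∀ K ∈ 𝒦, #X ≤ #(Prod.fst '' K) → ∃ x, (x, f x) ∈ K) ∧
      ∀ F ∈ Φ, ∃ T : Set X, #T < #X ∧ ∀ f ∈ 𝒢, ∀ g ∈ 𝒢, ∀ φ : X → X,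
        (∀ x, F (x, f x) = (φ x, g (φ x))) → ∀ x, φ x = x ∨ x ∈ T ∨ φ x ∈ T := by
  classical
  obtain ⟨𝒢, h𝒢, h⟩ := exists_large_family_extending (I := 𝒦 ⊕ Φ)
    (by simpa using add_le_of_le (aleph0_le_mk X) h𝒦 hΦ)
    (R := Sum.elim (fun K => {s | ∃ p ∈ K.1, s = {p}}) fun F =>
      {s | ∃ p q, p.1 ≠ q.1 ∧ q.1 = (F.1 p).1 ∧ q.2 ≠ (F.1 p).2 ∧ s = {p, q}}) (by
      rintro (K | F) s hs
      · obtain ⟨p, -, rfl⟩ := hs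
        simp
      · obtain ⟨p, q, hpq, -, -, rfl⟩ := hs
        simp [hpq])
  refine ⟨𝒢, h𝒢, fun f hf K hK hcard => ?_, fun F hF => ?_⟩
  · rcases h (.inl ⟨K, hK⟩) with ⟨_, ⟨p, hp, rfl⟩, hfp⟩ | ⟨T, hT, hKT⟩
    · exact ⟨p.1, by rwa [hfp f hf p (Finset.mem_singleton_self p)]⟩
    · have hsub : Prod.fst '' K ⊆ T := by
        rintro _ ⟨p, hp, rfl⟩
        simpa using hKT _ ⟨p, hp, rfl⟩
      exact absurd ((mk_le_mk_of_subset hsub).trans_lt hT) hcard.not_gt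
  · rcases h (.inr ⟨F, hF⟩) with ⟨_, ⟨p, q, -, hq₁, hq₂, rfl⟩, hpq⟩ | ⟨T, hT, hFT⟩
    · refine ⟨∅, by simp [pos_iff_ne_zero], fun f hf g hg φ hφ => absurd ?_ hq₂⟩
      replace hq₁ : q.1 = (F p).1 := hq₁
      have hfp : f p.1 = p.2 := hpq f hf p (by simp)
      have hgq : g q.1 = q.2 := hpq g hg q (by simp)
      have hFp : F p = (φ p.1, g (φ p.1)) := by rw [← hφ, hfp]
      calc q.2 = g (φ p.1) := by rw [← hgq, hq₁, hFp]
        _ = (F p).2 := by rw [hFp]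
    · refine ⟨T, hT, fun f _ g _ φ hφ x => or_iff_not_imp_left.2 fun hx => ?_⟩
      obtain ⟨y, hy⟩ := exists_ne (g (φ x))
      simpa using hFT {(x, f x), (φ x, y)} ⟨(x, f x), (φ x, y), Ne.symm hx,
        (congrArg Prod.fst (hφ x)).symm, fun h => hy (h.trans (congrArg Prod.snd (hφ x))), rfl⟩

/-! ### Cardinalities in second countable and in connected spaces -/

theorem mk_setOfPred_isClosed_le_continuum (X : Type u) [TopologicalSpace X]
    [SecondCountableTopology X] : #{K : Set X | IsClosed K} ≤ 𝔠 := by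
  refine (mk_le_mk_of_subset fun K (hK : IsClosed K) => ?_).trans
    (MeasurableSpace.cardinal_measurableSet_le_continuum
      ((countable_countableBasis X).le_aleph0.trans aleph0_le_continuum))
  have hK' : @MeasurableSet X (borel X) K :=
    .of_compl (MeasurableSpace.measurableSet_generateFrom hK.isOpen_compl)
  rwa [borel_eq_generateFrom_of_subbasis (isBasis_countableBasis X).eq_generateFrom] at hK'

theorem mk_le_continuum_of_secondCountable (X : Type u) [TopologicalSpace X] [T0Space X]
    [SecondCountableTopology X] : #X ≤ 𝔠 :=
  (mk_le_of_injective (f := fun x : X => (⟨closure {x}, isClosed_closure⟩ : {K | IsClosed K}))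
    fun _ _ h => (inseparable_iff_closure_eq.2 (congrArg Subtype.val h)).eq).trans
    (mk_setOfPred_isClosed_le_continuum X)

theorem mk_setOfPred_continuous_le (X Y : Type u) [TopologicalSpace X] [SeparableSpace X]
    [Nonempty X] [TopologicalSpace Y] [T2Space Y] : #{f : X → Y | Continuous f} ≤ #Y ^ ℵ₀ := by
  obtain ⟨e, he⟩ := exists_dense_seq X
  calc #{f : X → Y | Continuous f} ≤ #(ℕ → Y) :=
        mk_le_of_injective (f := fun f n => f.1 (e n)) fun f g hfg =>
          Subtype.ext (he.equalizer f.2 g.2 hfg)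
    _ = #Y ^ ℵ₀ := by simp

/-- Spaces whose dispersion character, the least cardinality of a nonempty open set, is at least
the continuum. -/
class HasContinuumDispersion (X : Type u) [TopologicalSpace X] : Prop where
  continuum_le_mk : ∀ U : Set X, IsOpen U → U.Nonempty → 𝔠 ≤ #U

-- An Urysohn function that vanishes at a point of `U` and is `1` off `U` and somewhere else
-- takes every value in `[0, 1)`, and it does so on `U`.
instance (X : Type u) [TopologicalSpace X] [T35Space X] [PreconnectedSpace X] [Nontrivial X] :
    HasContinuumDispersion X where
  continuum_le_mk U hU := by
    rintro ⟨x, hx⟩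
    obtain ⟨y, hyx⟩ := exists_ne x
    obtain ⟨φ, hφ, hφx, hφU⟩ := CompletelyRegularSpace.completely_regular_isOpen x (U ∩ {y}ᶜ)
      (hU.inter isOpen_compl_singleton) ⟨hx, hyx.symm⟩
    have hφy : φ y = 1 := hφU (by simp)
    have hsub : Ico (0 : ℝ) 1 ⊆ (fun z => (φ z : ℝ)) '' U := fun t ht => by
      obtain ⟨z, hz⟩ := mem_range_of_exists_le_of_exists_ge
        (continuous_subtype_val.comp hφ) ⟨x, by simpa [hφx] using ht.1⟩
        ⟨y, by simpa [hφy] using ht.2.le⟩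
      refine ⟨z, by_contra fun hzU => ?_, hz⟩
      have hφz : φ z = 1 := hφU fun h => hzU h.1
      exact ht.2.ne (by simp [← hz, hφz])
    have := lift_le.{u}.2 ((mk_Ico_real zero_lt_one).ge.trans (mk_le_mk_of_subset hsub))
    simpa using this.trans mk_image_le_lift

theorem mk_eq_continuum_of_secondCountable (X : Type u) [TopologicalSpace X] [T0Space X]
    [SecondCountableTopology X] [HasContinuumDispersion X] [Nonempty X] : #X = 𝔠 :=
  (mk_le_continuum_of_secondCountable X).antisymm <| by
    simpa using HasContinuumDispersion.continuum_le_mk (univ : Set X) isOpen_univ univ_nonempty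

theorem eq_of_mk_setOfPred_ne_lt_continuum {X : Type u} {Y : Type v} [TopologicalSpace X]
    [HasContinuumDispersion X] [TopologicalSpace Y] [T2Space Y] {a b : X → Y} (ha : Continuous a)
    (hb : Continuous b) (hab : #{x | a x ≠ b x} < 𝔠) : a = b := by
  by_contra h
  exact (HasContinuumDispersion.continuum_le_mk _ (isOpen_ne_fun ha hb)
    (Function.ne_iff.1 h)).not_gt hab

/-! ### Graph topologies -/

section GraphSpace

variable {X : Type u} {Y : Type v}

/-- The set `X`, to be identified with the graph of `f` and equipped with the topology of the
graph. It is a type synonym because `X` carries a topology of its own. -/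
def GraphSpace (_f : X → Y) : Type u := X

namespace GraphSpace

/-- The abscissa of a point of the graph. -/
def base {f : X → Y} (x : GraphSpace f) : X := x

/-- The inclusion of the graph into the product. -/
def toProd {f : X → Y} (x : GraphSpace f) : X × Y := (x.base, f x.base)

instance (f : X → Y) [h : Nonempty X] : Nonempty (GraphSpace f) := h

variable [TopologicalSpace X] [TopologicalSpace Y]

instance (f : X → Y) : TopologicalSpace (GraphSpace f) := induced toProd inferInstance

variable {f : X → Y}

theorem isEmbedding_toProd : IsEmbedding (toProd : GraphSpace f → X × Y) :=
  ⟨⟨rfl⟩, fun _ _ h => congrArg Prod.fst h⟩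

instance [SecondCountableTopology X] [SecondCountableTopology Y] :
    SecondCountableTopology (GraphSpace f) :=
  isEmbedding_toProd.isInducing.secondCountableTopology

instance [T3Space X] [T3Space Y] : T3Space (GraphSpace f) :=
  isEmbedding_toProd.t3Space

theorem continuous_base : Continuous (base : GraphSpace f → X) :=
  continuous_fst.comp isEmbedding_toProd.continuous

theorem continuous_apply_base : Continuous fun x : GraphSpace f => f x.base :=
  continuous_snd.comp isEmbedding_toProd.continuous

end GraphSpace

variable [TopologicalSpace X] [TopologicalSpace Y]

/-- The topology on `X` for which `x ↦ (x, f x)` is an embedding into `X × Y`. -/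
abbrev graphTopology (f : X → Y) : TopologicalSpace X :=
  inferInstanceAs (TopologicalSpace (GraphSpace f))

theorem graphTopology_le (f : X → Y) : graphTopology f ≤ ‹TopologicalSpace X› :=
  fun _ hU => hU.preimage (GraphSpace.continuous_base (f := f))

theorem continuous_graphTopology (f : X → Y) : Continuous[graphTopology f, _] f :=
  GraphSpace.continuous_apply_base (f := f)

theorem nhds_ne_nhds_graphTopology {f : X → Y} {x : X} (hf : ¬ContinuousAt f x) :
    𝓝 x ≠ @nhds X (graphTopology f) x := fun h => hf <| by
  rw [ContinuousAt, h]
  exact @Continuous.tendsto _ _ (graphTopology f) _ _ (continuous_graphTopology f) x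

end GraphSpace

theorem mk_setOfPred_graphTopology_eq_le {X Y : Type u} [TopologicalSpace X] [TopologicalSpace Y]
    [SecondCountableTopology X] [SecondCountableTopology Y] [Nonempty X] [T2Space Y] (g : X → Y) :
    #{f : X → Y | graphTopology f = graphTopology g} ≤ 𝔠 :=
  calc #{f : X → Y | graphTopology f = graphTopology g}
      ≤ #{f : GraphSpace g → Y | Continuous f} :=
        mk_le_mk_of_subset fun f (hf : graphTopology f = graphTopology g) =>
          show Continuous[graphTopology g, _] f from hf ▸ continuous_graphTopology f
    _ ≤ #Y ^ ℵ₀ := mk_setOfPred_continuous_le _ _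
    _ ≤ 𝔠 := by
        rw [← continuum_power_aleph0]
        exact power_le_power_right (mk_le_continuum_of_secondCountable Y)

theorem mk_image_graphTopology {X Y : Type u} [TopologicalSpace X] [TopologicalSpace Y]
    [SecondCountableTopology X] [SecondCountableTopology Y] [Nonempty X] [T2Space Y]
    {𝒢 : Set (X → Y)} (h𝒢 : 𝔠 < #𝒢) : #(graphTopology '' 𝒢) = #𝒢 := by
  refine mk_image_le.antisymm ?_
  by_contra! hlt
  let G (f : 𝒢) : graphTopology '' 𝒢 := ⟨graphTopology f.1, mem_image_of_mem _ f.2⟩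
  have hfiber : ∀ τ, #(G ⁻¹' {τ}) ≤ 𝔠 := by
    rintro ⟨_, g, -, rfl⟩
    refine le_trans ?_ (mk_setOfPred_graphTopology_eq_le g)
    exact mk_le_of_injective (f := fun f => ⟨f.1.1, congrArg Subtype.val f.2⟩) fun f f' h =>
      Subtype.ext (Subtype.ext (congrArg Subtype.val h :))
  exact (mk_le_mk_mul_of_mk_preimage_le _ hfiber).not_gt
    (mul_lt_of_lt (aleph0_le_continuum.trans h𝒢.le) hlt h𝒢)

/-! ### Graphs meeting large closed sets -/

/-- The graph of `f` meets every closed subset of the product whose projection to the first factor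
has at least continuum many points. -/
def MeetsLargeClosedSets {X : Type u} {Y : Type v} [TopologicalSpace X] [TopologicalSpace Y]
    (f : X → Y) : Prop :=
  ∀ K : Set (X × Y), IsClosed K → 𝔠 ≤ #(Prod.fst '' K) → ∃ x, (x, f x) ∈ K

namespace MeetsLargeClosedSets

variable {X Y : Type u} [TopologicalSpace X] [TopologicalSpace Y]
  [HasContinuumDispersion X] {f : X → Y} {U V : Set (X × Y)}

theorem exists_fiber_subset (hf : MeetsLargeClosedSets f) (hU : IsOpen U)
    (hfU : ∀ x, (x, f x) ∈ U) {O : Set X} (hO : IsOpen O) (hne : O.Nonempty) :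
    ∃ c ∈ O, ∀ y, (c, y) ∈ U := by
  by_contra! h
  have hsub : O ⊆ Prod.fst '' Uᶜ := fun c hc => by
    obtain ⟨y, hy⟩ := h c hc
    exact ⟨(c, y), hy, rfl⟩
  obtain ⟨x, hx⟩ := hf Uᶜ hU.isClosed_compl
    ((HasContinuumDispersion.continuum_le_mk O hO hne).trans (mk_le_mk_of_subset hsub))
  exact hx (hfU x)

variable [RegularSpace X] [T1Space Y]

theorem surjOn_of_isOpen (hf : MeetsLargeClosedSets f) {O : Set X} (hO : IsOpen O)
    (hne : O.Nonempty) : SurjOn f O univ := by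
  rintro y -
  obtain ⟨x, hx⟩ := hne
  obtain ⟨A, hA, hAc, hAO⟩ := exists_mem_nhds_isClosed_subset (hO.mem_nhds hx)
  have hcard : 𝔠 ≤ #(Prod.fst '' (A ×ˢ {y})) := by
    rw [fst_image_prod _ (singleton_nonempty y)]
    exact (HasContinuumDispersion.continuum_le_mk _ isOpen_interior
      ⟨x, mem_interior_iff_mem_nhds.2 hA⟩).trans (mk_le_mk_of_subset interior_subset)
  obtain ⟨z, hzA, hz⟩ := hf (A ×ˢ {y}) (hAc.prod isClosed_singleton) hcard
  exact ⟨z, hAO hzA, hz⟩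

theorem not_continuousAt [Nontrivial Y] (hf : MeetsLargeClosedSets f) (x : X) :
    ¬ContinuousAt f x := fun h => by
  obtain ⟨y, hy⟩ := exists_ne (f x)
  obtain ⟨O, hOy, hO, hxO⟩ := eventually_nhds_iff.1 (h.eventually_ne hy.symm)
  obtain ⟨z, hz, hzy⟩ := hf.surjOn_of_isOpen hO ⟨x, hxO⟩ (mem_univ y)
  exact hOy z hz hzy

theorem exists_mem_of_isOpen (hf : MeetsLargeClosedSets f) (hU : IsOpen U) (hne : U.Nonempty) :
    ∃ x, (x, f x) ∈ U := by
  obtain ⟨⟨a, b⟩, hab⟩ := hne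
  obtain ⟨A, B, hA, -, ha, hb, hAB⟩ := isOpen_prod_iff.1 hU a b hab
  obtain ⟨x, hx, rfl⟩ := hf.surjOn_of_isOpen hA ⟨a, ha⟩ (mem_univ b)
  exact ⟨x, hAB ⟨hx, hb⟩⟩

theorem hasContinuumDispersion [HasContinuumDispersion Y] (hf : MeetsLargeClosedSets f) :
    HasContinuumDispersion (GraphSpace f) where
  continuum_le_mk V hV := by
    rintro ⟨x, hx⟩
    obtain ⟨W, hW, rfl⟩ := GraphSpace.isEmbedding_toProd.isOpen_iff.1 hV
    obtain ⟨A, B, hA, hB, hxA, hxB, hAB⟩ := isOpen_prod_iff.1 hW x.base (f x.base) hx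
    have hsub : B ⊆ (fun z : GraphSpace f => f z.base) '' (GraphSpace.toProd ⁻¹' W) := by
      intro y hy
      obtain ⟨z, hz, rfl⟩ := hf.surjOn_of_isOpen hA ⟨_, hxA⟩ (mem_univ y)
      exact ⟨z, hAB ⟨hz, hy⟩, rfl⟩
    exact (HasContinuumDispersion.continuum_le_mk B hB ⟨_, hxB⟩).trans
      ((mk_le_mk_of_subset hsub).trans mk_image_le)

theorem isOpen_setOfPred_mem_of_separation [PreconnectedSpace Y] (hf : MeetsLargeClosedSets f)
    (hU : IsOpen U) (hV : IsOpen V) (hcov : ∀ x, (x, f x) ∈ U ∪ V)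
    (hdisj : ∀ x, (x, f x) ∉ U ∩ V) : IsOpen {x | (x, f x) ∈ U} := by
  have hUV : ¬(U ∩ V).Nonempty := fun h => by
    obtain ⟨x, hx⟩ := hf.exists_mem_of_isOpen (hU.inter hV) h
    exact hdisj x hx
  have fiber_subset {c : X} (hc : ∀ y, (c, y) ∈ U ∪ V) {y y' : Y} (hy : (c, y) ∈ U) :
      (c, y') ∉ V := fun hy' => by
    obtain ⟨z, -, hz⟩ := isPreconnected_univ (Prod.mk c ⁻¹' U) (Prod.mk c ⁻¹' V)
      (hU.preimage (by fun_prop)) (hV.preimage (by fun_prop)) (fun y _ => hc y)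
      ⟨y, trivial, hy⟩ ⟨y', trivial, hy'⟩
    exact hUV ⟨_, hz⟩
  refine isOpen_iff_mem_nhds.2 fun x hx => ?_
  obtain ⟨A, B, hA, -, hxA, hxB, hAB⟩ := isOpen_prod_iff.1 hU x (f x) hx
  refine mem_of_superset (hA.mem_nhds hxA) fun c hc => (hcov c).resolve_right fun hcV => ?_
  obtain ⟨A', B', hA', -, hcA', hcB', hAB'⟩ := isOpen_prod_iff.1 hV c (f c) hcV
  obtain ⟨e, ⟨heA, heA'⟩, he⟩ :=
    hf.exists_fiber_subset (hU.union hV) hcov (hA.inter hA') ⟨c, hc, hcA'⟩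
  exact fiber_subset he (hAB ⟨heA, hxB⟩) (hAB' ⟨heA', hcB'⟩)

theorem preconnectedSpace [PreconnectedSpace X] [PreconnectedSpace Y]
    (hf : MeetsLargeClosedSets f) : PreconnectedSpace (GraphSpace f) := by
  refine preconnectedSpace_iff_clopen.2 fun s hs => ?_
  obtain ⟨U, hU, hUs⟩ := GraphSpace.isEmbedding_toProd.isOpen_iff.1 hs.isOpen
  obtain ⟨V, hV, hVs⟩ := GraphSpace.isEmbedding_toProd.isOpen_iff.1 hs.compl.isOpen
  have mem_V_iff (x : X) : (x, f x) ∈ V ↔ (x, f x) ∉ U := by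
    change (show GraphSpace f from x) ∈ GraphSpace.toProd ⁻¹' V ↔
      (show GraphSpace f from x) ∉ GraphSpace.toProd ⁻¹' U
    rw [hUs, hVs, mem_compl_iff]
  have hUopen : IsOpen {x | (x, f x) ∈ U} :=
    hf.isOpen_setOfPred_mem_of_separation hU hV (fun x => by simp [mem_V_iff, em])
      fun x => by simp [mem_V_iff]
  have hVopen : IsOpen {x | (x, f x) ∈ V} :=
    hf.isOpen_setOfPred_mem_of_separation hV hU (fun x => by simp [mem_V_iff, em'])
      fun x => by simp [mem_V_iff]
  have hclopen : IsClopen {x | (x, f x) ∈ U} :=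
    ⟨⟨by simpa only [compl_ofPred, ← mem_V_iff] using hVopen⟩, hUopen⟩
  rw [← hUs]
  exact (isClopen_iff (α := X)).1 hclopen

end MeetsLargeClosedSets

/-! ### Rigidity -/

/-- The extension by limits of the correspondence `(c n).1 ↦ (c n).2`. It is meant for sequences `c`
in the graph of a continuous map on a subspace of `A`, with first coordinates dense there; at the
points of `A` where the limit does not exist its value is arbitrary. -/
noncomputable def limitExtension {A : Type u} {B : Type v} [TopologicalSpace A] [TopologicalSpace B]
    [Nonempty B] (c : ℕ → A × B) (a : A) : B :=
  limUnder (comap (fun n => (c n).1) (𝓝 a)) fun n => (c n).2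

theorem exists_limitExtension_eq {A : Type u} {B : Type v} {S : Type*} [TopologicalSpace A]
    [TopologicalSpace B] [T2Space B] [Nonempty B] [TopologicalSpace S] [SeparableSpace S]
    [Nonempty S] {e : S → A} (he : IsInducing e) {u : S → B} (hu : Continuous u) :
    ∃ c : ℕ → A × B, ∀ s, limitExtension c (e s) = u s := by
  obtain ⟨d, hd⟩ := exists_dense_seq S
  refine ⟨fun n => (e (d n), u (d n)), fun s => ?_⟩
  have hcomap : comap (fun n => e (d n)) (𝓝 (e s)) = comap d (𝓝 s) := by
    rw [he.nhds_eq_comap, comap_comap, Function.comp_def]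
  have hne : (comap d (𝓝 s)).NeBot :=
    comap_neBot_iff_frequently.2 (mem_closure_iff_frequently.1 (hd s))
  rw [limitExtension, hcomap]
  exact ((hu.tendsto s).comp tendsto_comap).limUnder_eq

/-- Families of functions for which the only continuous injections between their graphs are the
inclusions, that is, the maps that preserve the first coordinate. -/
def RigidGraphs {X : Type u} {Y : Type v} [TopologicalSpace X] [TopologicalSpace Y]
    (𝒢 : Set (X → Y)) : Prop :=
  ∀ f ∈ 𝒢, ∀ g ∈ 𝒢, ∀ φ : GraphSpace f → GraphSpace g, Continuous φ → Function.Injective φ →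
    ∀ x, (φ x).base = x.base

theorem RigidGraphs.incomparable {X : Type u} {Y : Type v} [TopologicalSpace X]
    [TopologicalSpace Y] {𝒢 : Set (X → Y)} (h𝒢 : RigidGraphs 𝒢) :
    Incomparable (graphTopology '' 𝒢) := by
  rintro _ ⟨f, hf, rfl⟩ _ ⟨g, hg, rfl⟩ S ⟨h⟩
  let S' : Set (GraphSpace g) := S
  let h' : GraphSpace f ≃ₜ S' := h
  have hφ : IsEmbedding fun x => (h' x : GraphSpace g) := IsEmbedding.subtypeVal.comp h'.isEmbedding
  have hid : (fun x => (h' x : GraphSpace g)) = (id : X → X) :=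
    funext (h𝒢 f hf g hg _ hφ.continuous hφ.injective)
  constructor
  · have hind := hφ.eq_induced
    rw [hid] at hind
    exact hind.trans (@induced_id X (graphTopology g))
  · refine eq_univ_of_forall fun x => ?_
    rw [← show (h' x : GraphSpace g) = x from congrFun hid x]
    exact (h' x).2

theorem exists_large_rigidGraphs (X Y : Type u) [TopologicalSpace X] [TopologicalSpace Y]
    [T3Space X] [T2Space Y] [SecondCountableTopology X] [SecondCountableTopology Y]
    [HasContinuumDispersion X] [HasContinuumDispersion Y] [Nonempty X] [Nontrivial Y] :
    ∃ 𝒢 : Set (X → Y), 2 ^ 𝔠 ≤ #𝒢 ∧ (∀ f ∈ 𝒢, MeetsLargeClosedSets f) ∧ RigidGraphs 𝒢 := by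
  have hX : #X = 𝔠 := mk_eq_continuum_of_secondCountable X
  have : Infinite X := infinite_iff.2 (hX ▸ aleph0_le_continuum)
  have hΦ : #(range (limitExtension : (ℕ → (X × Y) × (X × Y)) → _)) ≤ #X :=
    mk_range_le.trans <| by
      simp [hX, mk_eq_continuum_of_secondCountable Y]
  obtain ⟨𝒢, h𝒢, hmeet, hrigid⟩ := exists_large_family_meeting_and_rigid
    (hX ▸ mk_setOfPred_isClosed_le_continuum (X × Y)) hΦ
  rw [hX] at h𝒢 hmeet hrigid
  refine ⟨𝒢, h𝒢, fun f hf => hmeet f hf, fun f hf g hg φ hφ hinj x => ?_⟩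
  have := MeetsLargeClosedSets.hasContinuumDispersion (hmeet f hf)
  obtain ⟨c, hc⟩ := exists_limitExtension_eq (GraphSpace.isEmbedding_toProd (f := f)).isInducing
    (GraphSpace.isEmbedding_toProd.continuous.comp hφ)
  obtain ⟨T, hT, hφT⟩ := hrigid _ ⟨c, rfl⟩
  have hsub : {x | (φ x).base ≠ x.base} ⊆ (T ∪ φ ⁻¹' T : Set X) := fun x hx =>
    (hφT f hf g hg φ hc x).resolve_left hx
  refine congrFun (eq_of_mk_setOfPred_ne_lt_continuum (GraphSpace.continuous_base.comp hφ)
    GraphSpace.continuous_base ?_) x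
  calc #{x | (φ x).base ≠ x.base} ≤ #(T ∪ φ ⁻¹' T : Set X) := mk_le_mk_of_subset hsub
    _ ≤ #T + #(φ ⁻¹' T : Set X) := mk_union_le _ _
    _ < 𝔠 := add_lt_of_lt aleph0_le_continuum hT
      ((mk_preimage_of_injective (β := X) φ T hinj).trans_lt hT)

theorem corollary1_general (X : Type u) [t : TopologicalSpace X] [T3Space X]
    [SecondCountableTopology X] [PreconnectedSpace X] [Nontrivial X] :
    ∃ 𝓕 : Set (TopologicalSpace X), #𝓕 = 2 ^ 𝔠 ∧ Incomparable 𝓕 ∧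
      ∀ τ ∈ 𝓕, τ ≤ t ∧ (∀ x, 𝓝 x ≠ @nhds X τ x) ∧ @ConnectedSpace X τ ∧
        @SeparableSpace X τ ∧ @MetrizableSpace X τ := by
  obtain ⟨𝒢, h𝒢, hmeet, hrigid⟩ := exists_large_rigidGraphs X X
  have hle : #𝒢 ≤ 2 ^ 𝔠 := by
    calc #𝒢 ≤ #X ^ #X := by simpa using mk_set_le 𝒢
      _ = 2 ^ 𝔠 := by
        rw [mk_eq_continuum_of_secondCountable X, power_self_eq aleph0_le_continuum]
  refine ⟨graphTopology '' 𝒢,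
    (mk_image_graphTopology ((cantor 𝔠).trans_le h𝒢)).trans (hle.antisymm h𝒢),
    hrigid.incomparable, ?_⟩
  rintro _ ⟨f, hf, rfl⟩
  have : PreconnectedSpace (GraphSpace f) := (hmeet f hf).preconnectedSpace
  have : MetrizableSpace (GraphSpace f) := metrizableSpace_of_t3_secondCountable _
  exact ⟨graphTopology_le f, fun x => nhds_ne_nhds_graphTopology ((hmeet f hf).not_continuousAt x),
    ConnectedSpace.mk (α := GraphSpace f) inferInstance,
    inferInstanceAs (SeparableSpace (GraphSpace f)), this⟩

theorem corollary1 :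
    ∃ 𝓕 : Set (TopologicalSpace ℝ),
      Cardinal.mk 𝓕 = 2 ^ Cardinal.continuum ∧
      Incomparable 𝓕 ∧
      ∀ τ ∈ 𝓕,
        RefinesEuclidean τ ∧
        strictPoints τ = Set.univ ∧
        @ConnectedSpace ℝ τ ∧
        @TopologicalSpace.SeparableSpace ℝ τ ∧
        @TopologicalSpace.MetrizableSpace ℝ τ := by
  obtain ⟨𝓕, hcard, hinc, h𝓕⟩ := corollary1_general ℝ
  exact ⟨𝓕, hcard, hinc, fun τ hτ => (h𝓕 τ hτ).imp_right (And.imp_left eq_univ_of_forall)⟩
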